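/- Let $H$ be a separable (real or complex) Hilbert space, $0<\alpha\le 1$, $T>0$, and let $A:D(A)\subset H\to H$ be a densely defined self-adjoint operator that is bounded above, i.e. $\langle Au,u\rangle\le\kappa\|u\|^2$ for all $u\in D(A)$ with some $\kappa\ge 0$, and has compact resolvent, i.e. $(\mu I-A)^{-1}$ exists and is a compact operator on $H$ for some real $\mu>-\kappa$. Denote by $\partial_t^\alpha g(t)=\frac{1}{\Gamma(1-\alpha)}\int_0^t (t-s)^{-\alpha}g'(s)\,ds$ for $0<\alpha<1$ and $\partial_t^1 g=g'$ the Caputo derivative, and let $E_{\alpha,1}(z)=\sum_{k\ge 0}z^k/\Gamma(\alpha k+1)$. A solution of the backward problem with final value $u_T\in H$ is a function $u\in C([0,T];H)$ with $u(T)=u_T$ such that, for every $t\in(0,T)$, $u(t)\in D(A)$, the Caputo derivative $\partial_t^\alpha u(t)$ exists, and $\partial_t^\alpha u(t)=Au(t)$. Here it suffices that the derivative and the equation hold weakly, that is, for every $v\in H$ and $t\in(0,T)$ the scalar function $\langle u(\cdot),v\rangle$ has a Caputo derivative at $t$, equal to $\langle Au(t),v\rangle$; for $0<\alpha<1$ the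 existence of the Caputo derivative at $t$ means that the scalar function is absolutely continuous on $[0,t]$ and that the integral converges absolutely. Then there exists a constant $K\ge 1$, depending only on $A$, $\kappa$, $\alpha$ and $T$, such that for every $u_T\in H$ and every solution $u$ with $u(T)=u_T$, $$\|u(t)\|\le K\,\|u(0)\|^{1-\frac tT}\,\|u(T)\|^{\frac tT},\qquad 0\le t\le T.$$ If $\lambda_1$ is the smallest eigenvalue of $-A$, then $K$ can be chosen with $K\le 1+E_{\alpha,1}(-\lambda_1T^\alpha)$. Moreover, if $\kappa=0$, then one can choose $K=1$. -/

import Mathlib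

open MeasureTheory Set

/-- `HasCaputoDerivAt α g w t`: the Caputo derivative of order `α ∈ (0, 1]` (with base point `0`)
of `g : ℝ → E` at the time `t > 0` is defined and equals `w`.
For `α = 1` it is the usual derivative. For `0 < α < 1` it is
`1 / Γ(1 - α) * ∫ s in 0..t, (t - s) ^ (-α) * g'(s)`, where being defined means that `g` is
absolutely continuous on `[0, t]`, has a derivative at almost every point there (automatic when `E`
is finite-dimensional), and the integrand is integrable. -/
def HasCaputoDerivAt {E : Type*} [NormedAddCommGroup E] [NormedSpace ℝ E]
    (α : ℝ) (g : ℝ → E) (w : E) (t : ℝ) : Prop :=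
  (α = 1 → HasDerivAt g w t) ∧
  (α < 1 →
    AbsolutelyContinuousOnInterval g 0 t ∧
    (∀ᵐ s ∂(volume : Measure ℝ), s ∈ Ioo 0 t → DifferentiableAt ℝ g s) ∧
    IntervalIntegrable (fun s : ℝ => (t - s) ^ (-α) • deriv g s) volume 0 t ∧
    (Real.Gamma (1 - α))⁻¹ • ∫ s in (0 : ℝ)..t, (t - s) ^ (-α) • deriv g s = w)

/-- Continuous linear maps commute with the Caputo derivative. In particular, if `∂ₜ^α u(t) = w`
in the strong sense (with a Bochner integral) in a Hilbert space, then `∂ₜ^α ⟨v, u⟩(t) = ⟨v, w⟩`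
for every vector `v`. -/
theorem HasCaputoDerivAt.clm_comp {E F : Type*} [NormedAddCommGroup E] [NormedSpace ℝ E]
    [CompleteSpace E] [NormedAddCommGroup F] [NormedSpace ℝ F] [CompleteSpace F]
    (L : E →L[ℝ] F) {α : ℝ} {g : ℝ → E} {w : E} {t : ℝ} (ht : 0 < t)
    (h : HasCaputoDerivAt α g w t) :
    HasCaputoDerivAt α (fun s => L (g s)) (L w) t := by
  refine ⟨fun hα => L.hasFDerivAt.comp_hasDerivAt t (h.1 hα), fun hα => ?_⟩
  obtain ⟨hac, hd, hi, hw⟩ := h.2 hα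
  have hae : ∀ᵐ s ∂(volume : Measure ℝ), s ∈ uIoc 0 t →
      L ((t - s) ^ (-α) • deriv g s) = (t - s) ^ (-α) • deriv (fun s => L (g s)) s := by
    have hne : ∀ᵐ s ∂(volume : Measure ℝ), s ≠ t := by simp [ae_iff]
    filter_upwards [hd, hne] with s hs hst hmem
    rw [uIoc_of_le ht.le] at hmem
    have h1 := (hs ⟨hmem.1, lt_of_le_of_ne hmem.2 hst⟩).hasDerivAt
    have h2 : HasDerivAt (fun s => L (g s)) (L (deriv g s)) s :=
      L.hasFDerivAt.comp_hasDerivAt s h1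
    rw [h2.deriv, map_smul]
  refine ⟨?_, ?_, ?_, ?_⟩
  · unfold AbsolutelyContinuousOnInterval at hac ⊢
    refine squeeze_zero (fun E => Finset.sum_nonneg fun _ _ => dist_nonneg) (fun E => ?_)
      (by simpa using hac.const_mul ‖L‖)
    rw [Finset.mul_sum]
    refine Finset.sum_le_sum fun i _ => ?_
    rw [dist_eq_norm, dist_eq_norm, ← map_sub]
    exact L.le_opNorm _
  · filter_upwards [hd] with s hs hmem
    exact (L.differentiableAt).comp s (hs hmem)
  · have h3 : IntervalIntegrable (fun s => L ((t - s) ^ (-α) • deriv g s)) volume 0 t :=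
      ⟨L.integrable_comp hi.1, L.integrable_comp hi.2⟩
    refine h3.congr_ae ?_
    exact (ae_restrict_iff' measurableSet_uIoc).2 hae
  · rw [← hw, map_smul, ← L.intervalIntegral_comp_comm hi]
    congr 1
    exact (intervalIntegral.integral_congr_ae hae).symm

/-- The two-parameter Mittag-Leffler function `E_{α,β}` at real arguments. -/
noncomputable def mittagLeffler (α β z : ℝ) : ℝ :=
  ∑' k : ℕ, z ^ k / Real.Gamma (α * k + β)

section Operators

variable {𝕜 H : Type*} [RCLike 𝕜] [NormedAddCommGroup H] [InnerProductSpace 𝕜 H]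

/-- The operator `A` is bounded above by `κ`: `⟨A x, x⟩ ≤ κ ‖x‖²` on the domain of `A`. -/
def IsBoundedAboveBy (A : H →ₗ.[𝕜] H) (κ : ℝ) : Prop :=
  ∀ x : A.domain, RCLike.re (inner 𝕜 (A x) (x : H)) ≤ κ * ‖(x : H)‖ ^ 2

/-- `R` is the resolvent `(μ I - A)⁻¹`, an everywhere defined bounded operator. -/
def IsResolventOf (A : H →ₗ.[𝕜] H) (μ : ℝ) (R : H →L[𝕜] H) : Prop :=
  (∀ x : H, ∃ h : R x ∈ A.domain, (μ : 𝕜) • R x - A ⟨R x, h⟩ = x) ∧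
  (∀ y : A.domain, R ((μ : 𝕜) • (y : H) - A y) = y)

/-- `λ₁` is the first (smallest) eigenvalue of `-A`. -/
def IsFirstEigenvalueNeg (A : H →ₗ.[𝕜] H) (lam : ℝ) : Prop :=
  IsLeast {l : ℝ | ∃ x : A.domain, (x : H) ≠ 0 ∧ -(A x) = (l : 𝕜) • (x : H)} lam

/-- `u` is a solution of `∂ₜ^α u(t) = A u(t)`, `0 < t < T`, with final value `u(T) = uT`: it is
continuous from `[0, T]` to `H`, takes values in the domain of `A` on `(0, T)`, and the equation
holds for every `t ∈ (0, T)`, the Caputo derivative of the `H`-valued function `u` being taken in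
the weak sense, that is, after pairing with an arbitrary `v : H`. (By `HasCaputoDerivAt.clm_comp`
every function for which the equation holds with the Bochner integral is a solution here.) -/
structure IsBackwardSolution (α T : ℝ) (A : H →ₗ.[𝕜] H) (uT : H) (u : ℝ → H) : Prop where
  continuousOn : ContinuousOn u (Icc 0 T)
  equation : ∀ t ∈ Ioo 0 T, ∃ h : u t ∈ A.domain,
    ∀ v : H, HasCaputoDerivAt α (fun s => inner 𝕜 v (u s)) (inner 𝕜 v (A ⟨u t, h⟩)) t
  final : u T = uT

end Operators

/-! The compact symmetric resolvent diagonalises `A` in a Hilbert basis with real eigenvalues `-lam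
i` (`IsResolventOf.exists_hilbertBasis`). Pairing the equation with a basis vector gives a scalar
relaxation equation, so the coefficient at time `t` is `E(-lam i * t ^ α)` times the initial one
(`eq_mul_mittagLeffler_of_hasCaputoDerivAt`). The estimate thus reduces to `E(-λ t^α) ≤ K E(-λ
T^α)^(t/T)` uniformly in the spectrum (`mittagLeffler_rpow_le`), followed by Hölder's inequality for
the squared coefficients (`le_rpow_mul_rpow_of_hasSum`).

For `λ ≥ 0` the scalar inequality holds with constant `1`, because `z ↦ E(-z)` is the Laplace
transform of a probability law on the half-line, whence `F(θz) ≤ F(z)^θ` by Jensen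
(`isSubLogConvex_mittagLeffler`). The law itself is never constructed: explicit mixtures of
exponentials inherit the inequality by induction, and their rescaled moments converge to `k! /
Γ(αk+1)`. For `λ < 0` monotonicity of `E` suffices and produces the constant. -/

/-! ### The Mittag-Leffler series -/

theorem Real.rpow_mul_exp_neg_le_Gamma_add_one {M y : ℝ} (hM : 0 < M) (hy : 0 ≤ y) :
    M ^ y * Real.exp (-M) ≤ Real.Gamma (y + 1) := by
  have hint : IntegrableOn (fun x : ℝ => Real.exp (-x) * x ^ (y + 1 - 1)) (Ioi 0) :=
    Real.GammaIntegral_convergent (by linarith)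
  rw [Real.Gamma_eq_integral (by linarith), ← integral_exp_neg_Ioi M, ← integral_const_mul]
  calc ∫ x in Ioi M, M ^ y * Real.exp (-x)
      ≤ ∫ x in Ioi M, Real.exp (-x) * x ^ (y + 1 - 1) := by
        refine setIntegral_mono_on ?_ (hint.mono_set (Ioi_subset_Ioi hM.le)) measurableSet_Ioi ?_
        · exact (integrableOn_exp_neg_Ioi M).const_mul _
        · intro x hx
          rw [mul_comm, add_sub_cancel_right]
          exact mul_le_mul_of_nonneg_left
            (Real.rpow_le_rpow hM.le (le_of_lt hx) hy) (Real.exp_pos _).le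
    _ ≤ ∫ x in Ioi 0, Real.exp (-x) * x ^ (y + 1 - 1) := by
        refine setIntegral_mono_set hint ?_ (Ioi_subset_Ioi hM.le).eventuallyLE
        filter_upwards [ae_restrict_mem measurableSet_Ioi] with x hx
        exact mul_nonneg (Real.exp_pos _).le (Real.rpow_nonneg (le_of_lt hx) _)

theorem summable_mittagLeffler {α : ℝ} (hα : 0 < α) (z : ℝ) :
    Summable fun k : ℕ => z ^ k / Real.Gamma (α * k + 1) := by
  -- Chosen so that `M ^ (α * k) = (2|z| + 1) ^ k`, which beats `|z| ^ k` by a factor `2 ^ k`.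
  set M : ℝ := (2 * |z| + 1) ^ α⁻¹ with hMdef
  have hb : 0 < 2 * |z| + 1 := by positivity
  have hM : 0 < M := Real.rpow_pos_of_pos hb _
  have hMα : M ^ α = 2 * |z| + 1 := by
    rw [hMdef, ← Real.rpow_mul hb.le, inv_mul_cancel₀ hα.ne', Real.rpow_one]
  refine Summable.of_norm_bounded (g := fun k : ℕ => Real.exp M * (1 / 2) ^ k)
    ((summable_geometric_two).mul_left _) fun k => ?_
  have hG := Real.rpow_mul_exp_neg_le_Gamma_add_one hM (by positivity : 0 ≤ α * k)
  have hGp : 0 < Real.Gamma (α * k + 1) := Real.Gamma_pos_of_pos (by positivity)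
  rw [norm_div, norm_pow, Real.norm_eq_abs, Real.norm_eq_abs, abs_of_pos hGp, div_le_iff₀ hGp]
  calc |z| ^ k ≤ (1 / 2 * (2 * |z| + 1)) ^ k := by gcongr; linarith
    _ = Real.exp M * (1 / 2) ^ k * (M ^ (α * k) * Real.exp (-M)) := by
        rw [Real.rpow_mul hM.le, hMα, Real.rpow_natCast, mul_pow, Real.exp_neg]
        field_simp
    _ ≤ _ := by gcongr

theorem hasSum_mittagLeffler {α : ℝ} (hα : 0 < α) (z : ℝ) :
    HasSum (fun k : ℕ => z ^ k / Real.Gamma (α * k + 1)) (mittagLeffler α 1 z) :=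
  (summable_mittagLeffler hα z).hasSum

theorem mittagLeffler_zero {α : ℝ} (hα : 0 < α) : mittagLeffler α 1 0 = 1 := by
  refine (hasSum_mittagLeffler hα 0).unique ?_
  convert hasSum_single (f := fun k : ℕ => (0 : ℝ) ^ k / Real.Gamma (α * k + 1)) 0 ?_ using 1
  · simp
  · intro k hk; simp [hk]

theorem mittagLeffler_mono {α : ℝ} (hα : 0 < α) {x y : ℝ} (hx : 0 ≤ x) (hxy : x ≤ y) :
    mittagLeffler α 1 x ≤ mittagLeffler α 1 y := by
  refine hasSum_le (fun k => ?_) (hasSum_mittagLeffler hα x) (hasSum_mittagLeffler hα y)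
  have : 0 < Real.Gamma (α * k + 1) := Real.Gamma_pos_of_pos (by positivity)
  gcongr

/-! ### Approximating laws and their moments -/

/-- Laplace transforms of the laws of `X₁ ⋯ Xₙ` with `Xⱼ` independent, `Xⱼ = 1` with
probability `α`, and `Xⱼ` beta-distributed with parameters `(j, 1)` otherwise. -/
noncomputable def betaMixture (α : ℝ) : ℕ → ℝ → ℝ
  | 0 => fun z => Real.exp (-z)
  | n + 1 => fun z =>
      α * betaMixture α n z + (1 - α) * ∫ r in (0 : ℝ)..1, betaMixture α n (z * r ^ ((n : ℝ) + 1)⁻¹)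

/-- The moments of the laws behind `betaMixture`. -/
noncomputable def betaMoment (α : ℝ) (n k : ℕ) : ℝ :=
  ∏ j ∈ Finset.range n, ((j : ℝ) + 1 + α * k) / ((j : ℝ) + 1 + k)

theorem continuous_betaMixture (α : ℝ) (n : ℕ) : Continuous (betaMixture α n) := by
  induction n with
  | zero => exact Real.continuous_exp.comp continuous_neg
  | succ n ih =>
    refine (continuous_const.mul ih).add (continuous_const.mul ?_)
    refine intervalIntegral.continuous_parametric_intervalIntegral_of_continuous' ?_ 0 1
    have : Continuous fun r : ℝ => r ^ ((n : ℝ) + 1)⁻¹ :=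
      Real.continuous_rpow_const (by positivity)
    exact ih.comp (continuous_fst.mul (this.comp continuous_snd))

theorem betaMoment_nonneg {α : ℝ} (hα : 0 ≤ α) (n k : ℕ) : 0 ≤ betaMoment α n k :=
  Finset.prod_nonneg fun j _ => by positivity

theorem betaMoment_le_one {α : ℝ} (hα : 0 ≤ α) (hα1 : α ≤ 1) (n k : ℕ) :
    betaMoment α n k ≤ 1 := by
  refine Finset.prod_le_one (fun j _ => by positivity) fun j _ => ?_
  rw [div_le_one (by positivity)]
  have : α * k ≤ 1 * k := by gcongr
  linarith

/-- Integrating termwise, the step from `n` to `n + 1` multiplies the `k`-th moment by `α + (1 -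
α)(n+1)/(n+1+k) = (n+1+αk)/(n+1+k)`. -/
theorem hasSum_betaMixture {α : ℝ} (hα : 0 ≤ α) (hα1 : α ≤ 1) (n : ℕ) (z : ℝ) :
    HasSum (fun k : ℕ => (-z) ^ k / k.factorial * betaMoment α n k) (betaMixture α n z) := by
  induction n generalizing z with
  | zero =>
    simp only [betaMoment, Finset.range_zero, Finset.prod_empty, mul_one, betaMixture]
    rw [Real.exp_eq_exp_ℝ]
    exact NormedSpace.expSeries_div_hasSum_exp (-z)
  | succ n ih =>
    have hI : HasSum (fun k : ℕ => ∫ r in (0 : ℝ)..1,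
          (-(z * r ^ ((n : ℝ) + 1)⁻¹)) ^ k / k.factorial * betaMoment α n k)
        (∫ r in (0 : ℝ)..1, betaMixture α n (z * r ^ ((n : ℝ) + 1)⁻¹)) := by
      refine intervalIntegral.hasSum_integral_of_dominated_convergence
        (fun k _ => |z| ^ k / k.factorial) (fun k => ?_) (fun k => ?_) ?_ ?_ ?_
      · have : Continuous fun r : ℝ => r ^ ((n : ℝ) + 1)⁻¹ :=
          Real.continuous_rpow_const (by positivity)
        exact Continuous.aestronglyMeasurable (by fun_prop)
      · refine Filter.Eventually.of_forall fun r hr => ?_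
        rw [uIoc_of_le zero_le_one] at hr
        rw [norm_mul, norm_div, norm_pow, norm_neg, norm_mul, Real.norm_eq_abs z,
          Real.norm_of_nonneg (betaMoment_nonneg hα n k),
          Real.norm_of_nonneg (Real.rpow_nonneg hr.1.le _),
          Real.norm_of_nonneg (Nat.cast_nonneg _)]
        have h1 : r ^ ((n : ℝ) + 1)⁻¹ ≤ 1 := Real.rpow_le_one hr.1.le hr.2 (by positivity)
        have h0 : 0 ≤ r ^ ((n : ℝ) + 1)⁻¹ := Real.rpow_nonneg hr.1.le _
        have h2 := betaMoment_le_one hα hα1 n k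
        have h3 : (|z| * r ^ ((n : ℝ) + 1)⁻¹) ^ k ≤ |z| ^ k := by
          gcongr
          exact mul_le_of_le_one_right (abs_nonneg _) h1
        calc _ ≤ (|z| * r ^ ((n : ℝ) + 1)⁻¹) ^ k / k.factorial :=
              mul_le_of_le_one_right (by positivity) h2
          _ ≤ _ := by gcongr
      · exact Filter.Eventually.of_forall fun r _ => Real.summable_pow_div_factorial _
      · exact intervalIntegrable_const
      · exact Filter.Eventually.of_forall fun r _ => ih _
    have h := ((ih z).mul_left α).add (hI.mul_left (1 - α))
    refine h.congr_fun fun k => ?_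
    have hpow : ∫ r in (0 : ℝ)..1, (r ^ ((n : ℝ) + 1)⁻¹) ^ k
        = ((n : ℝ) + 1) / ((n : ℝ) + 1 + k) := by
      rw [intervalIntegral.integral_congr (g := fun r : ℝ => r ^ (((n : ℝ) + 1)⁻¹ * k))]
      · have hk : 0 ≤ ((n : ℝ) + 1)⁻¹ * k := by positivity
        rw [integral_rpow (Or.inl (by linarith)), Real.one_rpow,
          Real.zero_rpow (by positivity), sub_zero]
        field_simp
        ring
      · intro r hr
        rw [uIcc_of_le zero_le_one] at hr
        simp only
        rw [Real.rpow_mul hr.1, Real.rpow_natCast]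
    have hterm : ∫ r in (0 : ℝ)..1,
        (-(z * r ^ ((n : ℝ) + 1)⁻¹)) ^ k / k.factorial * betaMoment α n k
        = (-z) ^ k / k.factorial * betaMoment α n k * (((n : ℝ) + 1) / ((n : ℝ) + 1 + k)) := by
      rw [← hpow, ← intervalIntegral.integral_const_mul]
      congr 1
      ext r
      rw [← neg_mul, mul_pow]
      ring
    rw [hterm, betaMoment, Finset.prod_range_succ, ← betaMoment]
    field_simp
    ring

/-! ### The inequality `F(θz) ≤ F(z)^θ` and its stability -/

/-- A substitute for log-convexity of a function with value `1` at the origin. -/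
structure IsSubLogConvex (F : ℝ → ℝ) : Prop where
  nonneg : ∀ z, 0 ≤ z → 0 ≤ F z
  le_one : ∀ z, 0 ≤ z → F z ≤ 1
  le_rpow : ∀ z θ, 0 ≤ z → 0 ≤ θ → θ ≤ 1 → F (θ * z) ≤ F z ^ θ

theorem IsSubLogConvex.comp_const_mul {F : ℝ → ℝ} (hF : IsSubLogConvex F) {c : ℝ} (hc : 0 ≤ c) :
    IsSubLogConvex fun z => F (c * z) where
  nonneg z hz := hF.nonneg _ (mul_nonneg hc hz)
  le_one z hz := hF.le_one _ (mul_nonneg hc hz)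
  le_rpow z θ hz h0 h1 := by
    have := hF.le_rpow (c * z) θ (mul_nonneg hc hz) h0 h1
    rwa [mul_left_comm] at this

theorem IsSubLogConvex.of_tendsto {F : ℕ → ℝ → ℝ} {G : ℝ → ℝ} (hF : ∀ n, IsSubLogConvex (F n))
    (h : ∀ z, 0 ≤ z → Filter.Tendsto (fun n => F n z) Filter.atTop (nhds (G z))) :
    IsSubLogConvex G where
  nonneg z hz := ge_of_tendsto' (h z hz) fun n => (hF n).nonneg z hz
  le_one z hz := le_of_tendsto' (h z hz) fun n => (hF n).le_one z hz
  le_rpow z θ hz h0 h1 :=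
    le_of_tendsto_of_tendsto' (h _ (mul_nonneg h0 hz)) ((h z hz).rpow_const (Or.inr h0))
      fun n => (hF n).le_rpow z θ hz h0 h1

/-- Mixing over dilations preserves the inequality because `x ↦ x ^ θ` is concave; this is used once
as Jensen's inequality in `r` and once for the two weights `α`, `1 - α`. -/
theorem IsSubLogConvex.mixture {F : ℝ → ℝ} (hF : IsSubLogConvex F) (hc : Continuous F)
    {α : ℝ} (hα : 0 ≤ α) (hα1 : α ≤ 1) {φ : ℝ → ℝ} (hφ : Continuous φ)
    (hφ0 : ∀ r ∈ Icc (0 : ℝ) 1, 0 ≤ φ r) :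
    IsSubLogConvex fun z => α * F z + (1 - α) * ∫ r in (0 : ℝ)..1, F (z * φ r) := by
  have hα' : 0 ≤ 1 - α := by linarith
  have hint : ∀ z, IntervalIntegrable (fun r => F (z * φ r)) volume 0 1 := fun z =>
    (hc.comp (continuous_const.mul hφ)).intervalIntegrable 0 1
  have hI0 : ∀ z, 0 ≤ z → 0 ≤ ∫ r in (0 : ℝ)..1, F (z * φ r) := fun z hz =>
    intervalIntegral.integral_nonneg zero_le_one fun r hr =>
      hF.nonneg _ (mul_nonneg hz (hφ0 r hr))
  refine ⟨fun z hz => ?_, fun z hz => ?_, fun z θ hz h0 h1 => ?_⟩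
  · exact add_nonneg (mul_nonneg hα (hF.nonneg z hz)) (mul_nonneg hα' (hI0 z hz))
  · have h2 : ∫ r in (0 : ℝ)..1, F (z * φ r) ≤ ∫ r in (0 : ℝ)..1, (1 : ℝ) :=
      intervalIntegral.integral_mono_on zero_le_one (hint z) intervalIntegrable_const
        fun r hr => hF.le_one _ (mul_nonneg hz (hφ0 r hr))
    rw [intervalIntegral.integral_const] at h2
    have h3 := hF.le_one z hz
    simp only [sub_zero, smul_eq_mul, mul_one] at h2
    nlinarith
  · have hcont : Continuous fun r => F (z * φ r) ^ θ :=
      (hc.comp (continuous_const.mul hφ)).rpow_const fun _ => Or.inr h0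
    have hconc := Real.concaveOn_rpow h0 h1
    have hjensen : ∫ r in (0 : ℝ)..1, F (z * φ r) ^ θ
        ≤ (∫ r in (0 : ℝ)..1, F (z * φ r)) ^ θ := by
      simp only [intervalIntegral.integral_of_le zero_le_one]
      have : IsProbabilityMeasure (volume.restrict (Ioc (0 : ℝ) 1)) := ⟨by simp⟩
      refine hconc.le_map_integral (f := fun r => F (z * φ r)) ?_ isClosed_Ici ?_ (hint z).1
        (hcont.intervalIntegrable 0 1).1
      · exact (Real.continuous_rpow_const h0).continuousOn
      · filter_upwards [ae_restrict_mem measurableSet_Ioc] with r hr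
        exact hF.nonneg _ (mul_nonneg hz (hφ0 r ⟨hr.1.le, hr.2⟩))
    have hmono : ∫ r in (0 : ℝ)..1, F (θ * z * φ r) ≤ ∫ r in (0 : ℝ)..1, F (z * φ r) ^ θ :=
      intervalIntegral.integral_mono_on zero_le_one (hint _) (hcont.intervalIntegrable 0 1)
        fun r hr => by
          rw [mul_assoc]
          exact hF.le_rpow _ _ (mul_nonneg hz (hφ0 r hr)) h0 h1
    calc α * F (θ * z) + (1 - α) * ∫ r in (0 : ℝ)..1, F (θ * z * φ r)
        ≤ α * F z ^ θ + (1 - α) * (∫ r in (0 : ℝ)..1, F (z * φ r)) ^ θ := by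
          gcongr
          · exact hF.le_rpow z θ hz h0 h1
          · exact hmono.trans hjensen
      _ ≤ _ := by
          have := hconc.2 (mem_Ici.2 (hF.nonneg z hz)) (mem_Ici.2 (hI0 z hz)) hα hα' (by ring)
          simpa only [smul_eq_mul] using this

theorem isSubLogConvex_betaMixture {α : ℝ} (hα : 0 ≤ α) (hα1 : α ≤ 1) (n : ℕ) :
    IsSubLogConvex (betaMixture α n) := by
  induction n with
  | zero =>
    refine ⟨fun z _ => (Real.exp_pos _).le, fun z hz => ?_, fun z θ _ _ _ => ?_⟩
    · simpa [betaMixture] using hz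
    · simp only [betaMixture]
      rw [← Real.exp_mul]
      exact (by ring_nf; rfl)
  | succ n ih =>
    exact ih.mixture (continuous_betaMixture α n) hα hα1
      (Real.continuous_rpow_const (by positivity)) fun r hr => Real.rpow_nonneg hr.1 _

/-! ### Convergence to the Mittag-Leffler function -/

/-- Normalising with `exp` of the harmonic number makes each new factor at least `1` by `1 + x ≤ exp
x`. Monotonicity bounds every moment by its limit, which is the domination needed in
`tendsto_betaMixture`. -/
theorem monotone_exp_harmonic_mul_betaMoment {α : ℝ} (hα : 0 ≤ α) (hα1 : α ≤ 1) (k : ℕ) :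
    Monotone fun n : ℕ => Real.exp ((1 - α) * harmonic n) ^ k * betaMoment α n k := by
  refine monotone_nat_of_le_succ fun n => ?_
  have hfac : 1 ≤ Real.exp ((1 - α) * ((n : ℝ) + 1)⁻¹) ^ k
      * (((n : ℝ) + 1 + α * k) / ((n : ℝ) + 1 + k)) := by
    rw [← Real.exp_nat_mul, ← mul_div_assoc, one_le_div (by positivity)]
    have h1 := Real.add_one_le_exp ((k : ℝ) * ((1 - α) * ((n : ℝ) + 1)⁻¹))
    have h2 : 0 ≤ (n : ℝ) + 1 + α * k := by positivity
    have h3 : (k * ((1 - α) * ((n : ℝ) + 1)⁻¹) + 1) * ((n : ℝ) + 1 + α * k)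
        = (n : ℝ) + 1 + k + α * (1 - α) * k ^ 2 * ((n : ℝ) + 1)⁻¹ := by
      field_simp
      ring
    have h4 : 0 ≤ α * (1 - α) * (k : ℝ) ^ 2 * ((n : ℝ) + 1)⁻¹ := by
      have : 0 ≤ 1 - α := by linarith
      positivity
    have h5 := mul_le_mul_of_nonneg_right h1 h2
    linarith
  have h0 : 0 ≤ Real.exp ((1 - α) * harmonic n) ^ k * betaMoment α n k :=
    mul_nonneg (by positivity) (betaMoment_nonneg hα n k)
  simp only [harmonic_succ, betaMoment, Finset.prod_range_succ]
  rw [← betaMoment]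
  push_cast
  rw [mul_add (1 - α), Real.exp_add, mul_pow]
  calc _ ≤ (Real.exp ((1 - α) * harmonic n) ^ k * betaMoment α n k) * _ :=
        le_mul_of_one_le_right h0 hfac
    _ = _ := by ring

/-- Euler's limit formula for `Γ`, with the factor `s` of the product cancelled. -/
theorem tendsto_rpow_mul_factorial_div_prod {s : ℝ} (hs : 0 < s) :
    Filter.Tendsto (fun n : ℕ => (n : ℝ) ^ s * n.factorial /
        ∏ j ∈ Finset.range n, ((j : ℝ) + 1 + s))
      Filter.atTop (nhds (Real.Gamma (s + 1))) := by
  rw [Real.Gamma_add_one hs.ne']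
  refine ((Real.GammaSeq_tendsto_Gamma s).const_mul s).congr fun n => ?_
  rw [Real.GammaSeq, Finset.prod_range_succ']
  have : ∏ j ∈ Finset.range n, (s + ((j + 1 : ℕ) : ℝ))
      = ∏ j ∈ Finset.range n, ((j : ℝ) + 1 + s) :=
    Finset.prod_congr rfl fun j _ => by push_cast; ring
  rw [this]
  have : ∏ j ∈ Finset.range n, ((j : ℝ) + 1 + s) ≠ 0 :=
    Finset.prod_ne_zero_iff.2 fun j _ => by positivity
  field_simp
  simp [mul_comm]

/-- The moment is a quotient of two Euler products, at `s = k` and `s = α * k`. Trading `log n` for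
the harmonic number leaves the Euler–Mascheroni constant. -/
theorem tendsto_exp_harmonic_mul_betaMoment {α : ℝ} (hα : 0 < α) (k : ℕ) :
    Filter.Tendsto (fun n : ℕ => Real.exp ((1 - α) * harmonic n) ^ k * betaMoment α n k)
      Filter.atTop (nhds (Real.exp ((1 - α) * Real.eulerMascheroniConstant) ^ k *
        (k.factorial / Real.Gamma (α * k + 1)))) := by
  rcases Nat.eq_zero_or_pos k with rfl | hk
  · refine tendsto_const_nhds.congr' ?_ 
    filter_upwards with n
    have : betaMoment α n 0 = 1 := Finset.prod_eq_one fun j _ => by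
      simp only [Nat.cast_zero, mul_zero, add_zero]
      exact div_self (by positivity)
    simp [this]
  have hk' : (0 : ℝ) < k := by exact_mod_cast hk
  have hG : Real.Gamma (α * k + 1) ≠ 0 := (Real.Gamma_pos_of_pos (by positivity)).ne'
  have h1 := (tendsto_rpow_mul_factorial_div_prod hk').div
    (tendsto_rpow_mul_factorial_div_prod (mul_pos hα hk')) hG
  rw [Real.Gamma_nat_eq_factorial] at h1
  have h2 : Filter.Tendsto (fun n : ℕ => Real.exp ((1 - α) * (harmonic n - Real.log n)) ^ k)
      Filter.atTop (nhds (Real.exp ((1 - α) * Real.eulerMascheroniConstant) ^ k)) :=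
    ((Real.continuous_exp.tendsto _).comp
      (Real.tendsto_harmonic_sub_log.const_mul (1 - α))).pow k
  refine (h2.mul h1).congr' ?_
  filter_upwards [Filter.eventually_gt_atTop 0] with n hn
  have hn' : (0 : ℝ) < n := by exact_mod_cast hn
  have hp1 : ∏ j ∈ Finset.range n, ((j : ℝ) + 1 + k) ≠ 0 :=
    Finset.prod_ne_zero_iff.2 fun j _ => by positivity
  have hp2 : ∏ j ∈ Finset.range n, ((j : ℝ) + 1 + α * k) ≠ 0 :=
    Finset.prod_ne_zero_iff.2 fun j _ => by positivity
  have hexp : Real.exp ((1 - α) * (harmonic n - Real.log n)) ^ k * (n : ℝ) ^ (k : ℝ)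
      = Real.exp ((1 - α) * harmonic n) ^ k * (n : ℝ) ^ (α * k) := by
    rw [← Real.exp_nat_mul, ← Real.exp_nat_mul, Real.rpow_def_of_pos hn', Real.rpow_def_of_pos hn',
      ← Real.exp_add, ← Real.exp_add]
    congr 1
    ring
  have hna : (n : ℝ) ^ (α * k) ≠ 0 := (Real.rpow_pos_of_pos hn' _).ne'
  simp only [Pi.div_apply, betaMoment, Finset.prod_div_distrib]
  field_simp
  linear_combination hexp

theorem tendsto_betaMixture {α : ℝ} (hα : 0 < α) (hα1 : α ≤ 1) (z : ℝ) :
    Filter.Tendsto (fun n : ℕ => betaMixture α n (Real.exp ((1 - α) * harmonic n) * z))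
      Filter.atTop (nhds (mittagLeffler α 1
        (-(Real.exp ((1 - α) * Real.eulerMascheroniConstant) * z)))) := by
  set c := Real.exp ((1 - α) * Real.eulerMascheroniConstant) with hc
  have hle : ∀ n k : ℕ, Real.exp ((1 - α) * harmonic n) ^ k * betaMoment α n k
      ≤ c ^ k * (k.factorial / Real.Gamma (α * k + 1)) := fun n k =>
    (monotone_exp_harmonic_mul_betaMoment hα.le hα1 k).ge_of_tendsto
      (tendsto_exp_harmonic_mul_betaMoment hα k) n
  have hterm : ∀ n k : ℕ, (-(Real.exp ((1 - α) * harmonic n) * z)) ^ k / k.factorial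
      * betaMoment α n k = (-z) ^ k / k.factorial *
        (Real.exp ((1 - α) * harmonic n) ^ k * betaMoment α n k) := fun n k => by
    rw [← mul_neg, mul_pow]; ring
  have hlim : ∀ k : ℕ, (-z) ^ k / k.factorial * (c ^ k * (k.factorial / Real.Gamma (α * k + 1)))
      = (-(c * z)) ^ k / Real.Gamma (α * k + 1) := fun k => by
    rw [← mul_neg, mul_pow]
    have := Nat.factorial_ne_zero k
    field_simp
  have h := tendsto_tsum_of_dominated_convergence (β := ℕ) (𝓕 := Filter.atTop)
    (f := fun n k : ℕ => (-(Real.exp ((1 - α) * harmonic n) * z)) ^ k / k.factorial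
      * betaMoment α n k)
    (g := fun k : ℕ => (-(c * z)) ^ k / Real.Gamma (α * k + 1))
    (bound := fun k : ℕ => |c * z| ^ k / Real.Gamma (α * k + 1))
    (summable_mittagLeffler hα _) (fun k => ?_) (Filter.Eventually.of_forall fun n k => ?_)
  · simp only [(hasSum_betaMixture hα.le hα1 _ _).tsum_eq] at h
    exact h
  · simp only [hterm, ← hlim]
    exact (tendsto_exp_harmonic_mul_betaMoment hα k).const_mul _
  · have h0 : 0 ≤ Real.exp ((1 - α) * harmonic n) ^ k * betaMoment α n k :=
      mul_nonneg (by positivity) (betaMoment_nonneg hα.le n k)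
    rw [hterm, norm_mul, Real.norm_of_nonneg h0, norm_div, norm_pow, norm_neg, Real.norm_eq_abs z,
      Real.norm_of_nonneg (Nat.cast_nonneg _)]
    calc _ ≤ |z| ^ k / k.factorial * (c ^ k * (k.factorial / Real.Gamma (α * k + 1))) := by
          exact mul_le_mul_of_nonneg_left (hle n k) (by positivity)
      _ = _ := by
          rw [abs_mul, abs_of_pos (Real.exp_pos _ : 0 < c), mul_pow]
          have := Nat.factorial_ne_zero k
          field_simp
          rw [hc]

theorem isSubLogConvex_mittagLeffler {α : ℝ} (hα : 0 < α) (hα1 : α ≤ 1) :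
    IsSubLogConvex fun z => mittagLeffler α 1 (-z) := by
  set c := Real.exp ((1 - α) * Real.eulerMascheroniConstant) with hc
  have hc0 : 0 < c := Real.exp_pos _
  have h : IsSubLogConvex fun z => mittagLeffler α 1 (-(c * z)) :=
    IsSubLogConvex.of_tendsto
      (fun n => (isSubLogConvex_betaMixture hα.le hα1 n).comp_const_mul (Real.exp_pos _).le)
      fun z _ => tendsto_betaMixture hα hα1 z
  -- The property is invariant under dilation, so the constant `c` can be scaled away.
  simpa only [mul_inv_cancel_left₀ hc0.ne'] using h.comp_const_mul (inv_nonneg.2 hc0.le)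

theorem mittagLeffler_nonneg {α : ℝ} (hα : 0 < α) (hα1 : α ≤ 1) (z : ℝ) :
    0 ≤ mittagLeffler α 1 z := by
  rcases le_total z 0 with hz | hz
  · simpa using (isSubLogConvex_mittagLeffler hα hα1).nonneg (-z) (by linarith)
  · exact zero_le_one.trans ((mittagLeffler_zero hα).symm.le.trans (mittagLeffler_mono hα le_rfl hz))

/-- Logarithmic convexity of the relaxation function, up to the growth for negative rates. -/
theorem mittagLeffler_rpow_le {α T : ℝ} (hα : 0 < α) (hα1 : α ≤ 1) (hT : 0 < T) {m lam t : ℝ}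
    (hlam : -m ≤ lam) (ht0 : 0 ≤ t) (htT : t ≤ T) :
    mittagLeffler α 1 (-lam * t ^ α) ≤
      max 1 (mittagLeffler α 1 (m * T ^ α)) * mittagLeffler α 1 (-lam * T ^ α) ^ (t / T) := by
  have hθ0 : 0 ≤ t / T := by positivity
  have hθ1 : t / T ≤ 1 := (div_le_one hT).2 htT
  have hTα : 0 < T ^ α := Real.rpow_pos_of_pos hT α
  have htα : t ^ α ≤ T ^ α := Real.rpow_le_rpow ht0 htT hα.le
  have htα0 : 0 ≤ t ^ α := Real.rpow_nonneg ht0 α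
  have hET := mittagLeffler_nonneg hα hα1 (-lam * T ^ α)
  rcases le_or_gt 0 lam with hl | hl
  · have hS := isSubLogConvex_mittagLeffler hα hα1
    have hz : 0 ≤ lam * T ^ α := by positivity
    have h1 := hS.le_rpow (lam * T ^ α) ((t / T) ^ α) hz (by positivity)
      (Real.rpow_le_one hθ0 hθ1 hα.le)
    have h2 : (t / T) ^ α * (lam * T ^ α) = lam * t ^ α := by
      rw [Real.div_rpow ht0 hT.le]; field_simp
    rw [h2] at h1
    simp only [← neg_mul] at h1
    have h3 := hS.le_one _ hz
    simp only [← neg_mul] at h3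
    calc _ ≤ _ := h1
      _ ≤ mittagLeffler α 1 (-lam * T ^ α) ^ (t / T) :=
          -- The base is at most `1` and `t / T ≤ (t / T) ^ α`, so lowering the exponent increases
          -- the power.
          Real.rpow_le_rpow_of_exponent_ge' hET h3 hθ0 <| by
            simpa using Real.rpow_le_rpow_of_exponent_ge' hθ0 hθ1 hα.le hα1
      _ ≤ _ := le_mul_of_one_le_left (Real.rpow_nonneg hET _) (le_max_left _ _)
  · have h1 : 1 ≤ mittagLeffler α 1 (-lam * T ^ α) := by
      exact (mittagLeffler_zero hα).symm.le.trans
        (mittagLeffler_mono hα le_rfl (mul_nonneg (by linarith) hTα.le))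
    have h2 : mittagLeffler α 1 (-lam * t ^ α) ≤ mittagLeffler α 1 (m * T ^ α) :=
      mittagLeffler_mono hα (mul_nonneg (by linarith) htα0)
        (mul_le_mul (by linarith) htα htα0 (by linarith))
    calc _ ≤ _ := h2
      _ ≤ max 1 (mittagLeffler α 1 (m * T ^ α)) := le_max_right _ _
      _ ≤ _ := le_mul_of_one_le_right (zero_le_one.trans (le_max_left _ _))
          (Real.one_le_rpow h1 hθ0)

/-! ### Beta integrals and the scalar fractional equation -/

theorem integral_sub_rpow_mul_rpow {a b t : ℝ} (ha : 0 < a) (hb : 0 < b) (ht : 0 < t) :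
    ∫ s in (0 : ℝ)..t, (t - s) ^ (a - 1) * s ^ (b - 1)
      = t ^ (a + b - 1) * (Real.Gamma a * Real.Gamma b / Real.Gamma (a + b)) := by
  have h := Complex.betaIntegral_scaled (b : ℂ) (a : ℂ) ht
  rw [Complex.betaIntegral_eq_Gamma_mul_div _ _ (by simpa) (by simpa)] at h
  apply Complex.ofReal_injective
  rw [← intervalIntegral.integral_ofReal]
  have hcongr : ∫ s in (0 : ℝ)..t, (((t - s) ^ (a - 1) * s ^ (b - 1) : ℝ) : ℂ)
      = ∫ s in (0 : ℝ)..t, (s : ℂ) ^ ((b : ℂ) - 1) * ((t : ℂ) - s) ^ ((a : ℂ) - 1) := by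
    refine intervalIntegral.integral_congr fun s hs => ?_
    rw [uIcc_of_le ht.le] at hs
    simp only [Complex.ofReal_mul]
    rw [Complex.ofReal_cpow (sub_nonneg.2 hs.2), Complex.ofReal_cpow hs.1]
    push_cast
    ring
  rw [hcongr, h, add_comm a b, Complex.ofReal_mul, Complex.ofReal_cpow ht.le]
  push_cast
  rw [← Complex.ofReal_add, Complex.Gamma_ofReal, Complex.Gamma_ofReal, Complex.Gamma_ofReal]
  ring

theorem intervalIntegrable_sub_rpow_mul_rpow {a b t : ℝ} (ha : 0 < a) (hb : 0 < b) (ht : 0 < t) :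
    IntervalIntegrable (fun s : ℝ => (t - s) ^ (a - 1) * s ^ (b - 1)) volume 0 t := by
  -- A non-integrable function has integral `0` by convention, but the beta integral is positive.
  by_contra h
  have h1 := integral_sub_rpow_mul_rpow ha hb ht
  rw [intervalIntegral.integral_undef h] at h1
  have h2 := Real.Gamma_pos_of_pos ha
  have h3 := Real.Gamma_pos_of_pos hb
  have h4 := Real.Gamma_pos_of_pos (add_pos ha hb)
  have h5 := Real.rpow_pos_of_pos ht (a + b - 1)
  exact absurd h1 (by positivity)

theorem intervalIntegrable_sub_rpow {a t : ℝ} (ha : 0 < a) (ht : 0 < t) :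
    IntervalIntegrable (fun s : ℝ => (t - s) ^ (a - 1)) volume 0 t := by
  simpa using intervalIntegrable_sub_rpow_mul_rpow ha one_pos ht

theorem setIntegral_Ioo_rpow_mul_rpow {α s t : ℝ} (h0 : 0 < α) (h1 : α < 1) (hst : s < t) :
    IntegrableOn (fun τ : ℝ => (t - τ) ^ (α - 1) * (τ - s) ^ (-α)) (Ioo s t) ∧
    ∫ τ in Ioo s t, (t - τ) ^ (α - 1) * (τ - s) ^ (-α) = Real.Gamma α * Real.Gamma (1 - α) := by
  have hts : 0 < t - s := sub_pos.2 hst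
  have hi := (intervalIntegrable_sub_rpow_mul_rpow h0 (sub_pos.2 h1) hts).comp_sub_right s
  have he := integral_sub_rpow_mul_rpow h0 (sub_pos.2 h1) hts
  have hsimp : ∀ x : ℝ, (t - s - (x - s)) ^ (α - 1) * (x - s) ^ (1 - α - 1)
      = (t - x) ^ (α - 1) * (x - s) ^ (-α) := fun x => by
    rw [sub_sub_sub_cancel_right, show 1 - α - 1 = -α by ring]
  simp only [hsimp, zero_add, sub_add_cancel] at hi
  constructor
  · exact ((intervalIntegrable_iff_integrableOn_Ioo_of_le hst.le).1 hi)
  · rw [← integral_Ioc_eq_integral_Ioo, ← intervalIntegral.integral_of_le hst.le]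
    have hc := intervalIntegral.integral_comp_sub_right (a := s) (b := t)
      (fun x : ℝ => (t - s - x) ^ (α - 1) * x ^ (1 - α - 1)) s
    simp only [hsimp, sub_self] at hc
    rw [hc, he]
    simp

/-- The Riemann–Liouville integral inverts the Caputo derivative. -/
theorem HasCaputoDerivAt.integral_eq_of_lt_one {α t : ℝ} (h0 : 0 < α) (h1 : α < 1) (ht : 0 < t)
    {g w : ℝ → ℝ} (h : ∀ τ ∈ Ioc 0 t, HasCaputoDerivAt α g (w τ) τ) :
    ∫ τ in (0 : ℝ)..t, (t - τ) ^ (α - 1) * w τ = Real.Gamma α * (g t - g 0) := by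
  have hΓ : Real.Gamma (1 - α) ≠ 0 := (Real.Gamma_pos_of_pos (sub_pos.2 h1)).ne'
  have hac := ((h t ⟨ht, le_rfl⟩).2 h1).1
  have hg' : IntegrableOn (deriv g) (Ioo 0 t) :=
    (intervalIntegrable_iff_integrableOn_Ioo_of_le ht.le).1 hac.intervalIntegrable_deriv
  -- Fubini on the triangle `s < τ < t`: integrating `τ` out first leaves the constant `Γ(α) Γ(1 -
  -- α)` times `deriv g s`.
  set f : ℝ → ℝ → ℝ := fun τ s =>
    if s < τ then (t - τ) ^ (α - 1) * (τ - s) ^ (-α) * deriv g s else 0 with hf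
  have hfmeas : Measurable (Function.uncurry f) := by
    refine Measurable.ite (measurableSet_lt measurable_snd measurable_fst) ?_ measurable_const
    have := measurable_deriv g
    fun_prop
  have hsec : ∀ s ∈ Ioo 0 t, ∀ φ : ℝ → ℝ, (∫ τ in Ioo 0 t, if s < τ then φ τ else 0)
      = ∫ τ in Ioo s t, φ τ := fun s hs φ => by
    have : (fun τ => if s < τ then φ τ else 0) = (Ioi s).indicator φ := by
      ext τ; simp [indicator_apply]
    rw [this, setIntegral_indicator measurableSet_Ioi]
    congr 2
    ext x
    simp only [mem_inter_iff, mem_Ioo, mem_Ioi]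
    exact ⟨fun hx => ⟨hx.2, hx.1.2⟩, fun hx => ⟨⟨hs.1.trans hx.1, hx.2⟩, hx.1⟩⟩
  have hinner : ∀ τ ∈ Ioo 0 t, ∫ s in Ioo 0 t, f τ s
      = Real.Gamma (1 - α) * ((t - τ) ^ (α - 1) * w τ) := fun τ hτ => by
    obtain ⟨-, -, hi, hw⟩ := (h τ ⟨hτ.1, hτ.2.le⟩).2 h1
    have : f τ = (Iio τ).indicator
        fun s => (t - τ) ^ (α - 1) * ((τ - s) ^ (-α) • deriv g s) := by
      ext s; simp [hf, indicator_apply, mul_assoc]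
    rw [this, setIntegral_indicator measurableSet_Iio, Ioo_inter_Iio, min_eq_right hτ.2.le,
      integral_const_mul, ← integral_Ioc_eq_integral_Ioo, ← intervalIntegral.integral_of_le hτ.1.le,
      ← hw, smul_eq_mul]
    field_simp
  have hprod : Integrable (Function.uncurry f)
      ((volume.restrict (Ioo 0 t)).prod (volume.restrict (Ioo 0 t))) := by
    refine (integrable_prod_iff' hfmeas.aestronglyMeasurable).2 ⟨?_, ?_⟩
    · filter_upwards [ae_restrict_mem measurableSet_Ioo] with s hs
      have h2 := ((setIntegral_Ioo_rpow_mul_rpow h0 h1 hs.2).1.mul_const (deriv g s))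
      have : (fun τ => Function.uncurry f (τ, s)) = (Ioi s).indicator
          fun τ => (t - τ) ^ (α - 1) * (τ - s) ^ (-α) * deriv g s := by
        ext τ; simp [hf, indicator_apply]
      rw [this, integrable_indicator_iff measurableSet_Ioi, IntegrableOn,
        Measure.restrict_restrict measurableSet_Ioi]
      exact IntegrableOn.mono_set h2 fun x hx => ⟨hx.1, hx.2.2⟩
    · refine (hg'.norm.const_mul (Real.Gamma α * Real.Gamma (1 - α))).congr ?_
      filter_upwards [ae_restrict_mem measurableSet_Ioo] with s hs
      have : ∀ τ, ‖Function.uncurry f (τ, s)‖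
          = if s < τ then ‖(t - τ) ^ (α - 1) * (τ - s) ^ (-α)‖ * ‖deriv g s‖ else 0 := fun τ => by
        simp only [Function.uncurry, hf]
        split_ifs
        · rw [norm_mul]
        · rw [norm_zero]
      simp only [this]
      rw [hsec s hs, integral_mul_const, ← (setIntegral_Ioo_rpow_mul_rpow h0 h1 hs.2).2]
      congr 1
      refine setIntegral_congr_fun measurableSet_Ioo fun τ hτ => ?_
      rw [Real.norm_of_nonneg]
      exact mul_nonneg (Real.rpow_nonneg (sub_nonneg.2 hτ.2.le) _)
        (Real.rpow_nonneg (sub_nonneg.2 hτ.1.le) _)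
  have hswap := integral_integral_swap hprod
  have houter : ∀ s ∈ Ioo 0 t, ∫ τ in Ioo 0 t, f τ s
      = Real.Gamma α * Real.Gamma (1 - α) * deriv g s := fun s hs => by
    simp only [hf]
    rw [hsec s hs, integral_mul_const, (setIntegral_Ioo_rpow_mul_rpow h0 h1 hs.2).2]
  rw [setIntegral_congr_fun measurableSet_Ioo hinner, integral_const_mul,
    setIntegral_congr_fun measurableSet_Ioo houter, integral_const_mul, ← integral_Ioc_eq_integral_Ioo,
      ← integral_Ioc_eq_integral_Ioo, ← intervalIntegral.integral_of_le ht.le,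
      ← intervalIntegral.integral_of_le ht.le, hac.integral_deriv_eq_sub] at hswap
  apply mul_left_cancel₀ hΓ
  rw [hswap]
  ring

theorem HasCaputoDerivAt.eq_add_integral {α T : ℝ} (h0 : 0 < α) (h1 : α ≤ 1) {g w : ℝ → ℝ}
    (hg : ContinuousOn g (Icc 0 T)) (hw : ContinuousOn w (Icc 0 T))
    (h : ∀ τ ∈ Ioo 0 T, HasCaputoDerivAt α g (w τ) τ) {t : ℝ} (ht : t ∈ Ioo 0 T) :
    g t = g 0 + (Real.Gamma α)⁻¹ * ∫ τ in (0 : ℝ)..t, (t - τ) ^ (α - 1) * w τ := by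
  rcases h1.lt_or_eq with h1 | rfl
  · rw [HasCaputoDerivAt.integral_eq_of_lt_one h0 h1 ht.1 fun τ hτ => h τ ⟨hτ.1, hτ.2.trans_lt ht.2⟩,
      inv_mul_cancel_left₀ (Real.Gamma_pos_of_pos h0).ne']
    ring
  · have hsub : Icc 0 t ⊆ Icc 0 T := Icc_subset_Icc_right ht.2.le
    have := intervalIntegral.integral_eq_sub_of_hasDerivAt_of_le ht.1.le (hg.mono hsub)
      (fun τ hτ => (h τ ⟨hτ.1, hτ.2.trans ht.2⟩).1 rfl)
      (ContinuousOn.intervalIntegrable_of_Icc ht.1.le (hw.mono hsub))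
    simp [this]

/-- Picard iteration: the Volterra operator sends each term of the series to the next by the beta
integral, and the same computation propagates the error bound. The bound is a term of a convergent
series, hence tends to `0`. -/
theorem abs_sub_sum_le_of_volterra {α T lam M : ℝ} (h0 : 0 < α) {g : ℝ → ℝ}
    (hg : ContinuousOn g (Icc 0 T)) (hM : ∀ t ∈ Icc 0 T, |g t| ≤ M)
    (h : ∀ t ∈ Ioo 0 T, g t = g 0 + (Real.Gamma α)⁻¹ *
      ∫ τ in (0 : ℝ)..t, (t - τ) ^ (α - 1) * (-lam * g τ)) (n : ℕ) :
    ∀ t ∈ Ioo 0 T,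
      |g t - g 0 * ∑ k ∈ Finset.range n, (-lam * t ^ α) ^ k / Real.Gamma (α * k + 1)|
        ≤ M * ((|lam| * t ^ α) ^ n / Real.Gamma (α * n + 1)) := by
  have hΓ := Real.Gamma_pos_of_pos h0
  have hpow : ∀ (k : ℕ) (s : ℝ), 0 ≤ s → (s ^ α) ^ k = s ^ (α * k + 1 - 1) := fun k s hs => by
    rw [add_sub_cancel_right, Real.rpow_mul hs, Real.rpow_natCast]
  have hbeta : ∀ (k : ℕ) (t : ℝ), 0 < t →
      IntervalIntegrable (fun s : ℝ => (t - s) ^ (α - 1) * (s ^ α) ^ k) volume 0 t ∧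
      ∫ s in (0 : ℝ)..t, (t - s) ^ (α - 1) * (s ^ α) ^ k = (t ^ α) ^ (k + 1) *
        (Real.Gamma α * Real.Gamma (α * k + 1) / Real.Gamma (α * (k + 1 : ℕ) + 1)) :=
      fun k t ht => by
    have hk : 0 < α * k + 1 := by positivity
    have heq : EqOn (fun s : ℝ => (t - s) ^ (α - 1) * (s ^ α) ^ k)
        (fun s : ℝ => (t - s) ^ (α - 1) * s ^ (α * k + 1 - 1)) (uIcc 0 t) := fun s hs => by
      rw [uIcc_of_le ht.le] at hs
      simp only [hpow k s hs.1]
    constructor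
    · exact (intervalIntegrable_sub_rpow_mul_rpow h0 hk ht).congr
        (heq.symm.mono uIoc_subset_uIcc)
    · rw [intervalIntegral.integral_congr heq, integral_sub_rpow_mul_rpow h0 hk ht, hpow _ _ ht.le]
      push_cast
      ring_nf
  induction n with
  | zero => intro t ht; simpa using hM t (Ioo_subset_Icc_self ht)
  | succ n ih =>
    intro t ht
    have hsum_int : IntervalIntegrable (fun s : ℝ => ∑ k ∈ Finset.range n,
        (-lam) ^ k / Real.Gamma (α * k + 1) * ((t - s) ^ (α - 1) * (s ^ α) ^ k)) volume 0 t := by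
      simpa only [Finset.sum_fn] using IntervalIntegrable.sum (Finset.range n) fun k _ => (hbeta k t ht.1).1.const_mul _
    have hg_int : IntervalIntegrable (fun s : ℝ => (t - s) ^ (α - 1) * g s) volume 0 t := by
      refine (intervalIntegrable_sub_rpow h0 ht.1).mul_continuousOn (hg.mono ?_)
      rw [uIcc_of_le ht.1.le]
      exact Icc_subset_Icc_right ht.2.le
    have hkey : g t - g 0 * ∑ k ∈ Finset.range (n + 1), (-lam * t ^ α) ^ k / Real.Gamma (α * k + 1)
        = (Real.Gamma α)⁻¹ * -lam * ∫ s in (0 : ℝ)..t, (t - s) ^ (α - 1) *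
          (g s - g 0 * ∑ k ∈ Finset.range n, (-lam * s ^ α) ^ k / Real.Gamma (α * k + 1)) := by
      have hsplit : ∀ s : ℝ, (t - s) ^ (α - 1) *
          (g s - g 0 * ∑ k ∈ Finset.range n, (-lam * s ^ α) ^ k / Real.Gamma (α * k + 1))
          = (t - s) ^ (α - 1) * g s - g 0 * ∑ k ∈ Finset.range n,
            (-lam) ^ k / Real.Gamma (α * k + 1) * ((t - s) ^ (α - 1) * (s ^ α) ^ k) := fun s => by
        rw [mul_sub, mul_left_comm, Finset.mul_sum]
        congr 2
        refine Finset.sum_congr rfl fun k _ => ?_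
        rw [mul_pow]
        ring
      have hVolt : ∫ τ in (0 : ℝ)..t, (t - τ) ^ (α - 1) * (-lam * g τ)
          = -lam * ∫ τ in (0 : ℝ)..t, (t - τ) ^ (α - 1) * g τ := by
        rw [← intervalIntegral.integral_const_mul]
        congr 1
        ext τ
        ring
      simp only [hsplit]
      rw [intervalIntegral.integral_sub hg_int (hsum_int.const_mul _),
        intervalIntegral.integral_const_mul, intervalIntegral.integral_finsetSum
          fun k _ => (hbeta k t ht.1).1.const_mul _, Finset.sum_range_succ', h t ht, hVolt]
      simp only [intervalIntegral.integral_const_mul, (hbeta _ t ht.1).2]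
      have : ∑ k ∈ Finset.range n, (-lam * t ^ α) ^ (k + 1) / Real.Gamma (α * (k + 1 : ℕ) + 1)
          = (Real.Gamma α)⁻¹ * -lam * ∑ k ∈ Finset.range n, (-lam) ^ k / Real.Gamma (α * k + 1) *
            ((t ^ α) ^ (k + 1) * (Real.Gamma α * Real.Gamma (α * k + 1) /
              Real.Gamma (α * (k + 1 : ℕ) + 1))) := by
        rw [Finset.mul_sum]
        refine Finset.sum_congr rfl fun k _ => ?_
        have h2 : Real.Gamma (α * k + 1) ≠ 0 := (Real.Gamma_pos_of_pos (by positivity)).ne'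
        rw [mul_pow, pow_succ (-lam)]
        field_simp
      rw [this]
      simp
      ring
    have hbound : ∀ s ∈ Ioo 0 t, ‖(t - s) ^ (α - 1) *
        (g s - g 0 * ∑ k ∈ Finset.range n, (-lam * s ^ α) ^ k / Real.Gamma (α * k + 1))‖
        ≤ M * |lam| ^ n / Real.Gamma (α * n + 1) * ((t - s) ^ (α - 1) * (s ^ α) ^ n) :=
        fun s hs => by
      have hp : 0 ≤ (t - s) ^ (α - 1) := Real.rpow_nonneg (sub_nonneg.2 hs.2.le) _
      rw [norm_mul, Real.norm_of_nonneg hp, Real.norm_eq_abs]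
      calc _ ≤ (t - s) ^ (α - 1) * (M * ((|lam| * s ^ α) ^ n / Real.Gamma (α * n + 1))) :=
            mul_le_mul_of_nonneg_left (ih s ⟨hs.1, hs.2.trans ht.2⟩) hp
        _ = _ := by rw [mul_pow]; ring
    have hle := intervalIntegral.norm_integral_le_of_norm_le ht.1.le (f := fun s : ℝ =>
        (t - s) ^ (α - 1) *
          (g s - g 0 * ∑ k ∈ Finset.range n, (-lam * s ^ α) ^ k / Real.Gamma (α * k + 1)))
        (μ := volume) (by
          have hne : ∀ᵐ s ∂(volume : Measure ℝ), s ≠ t := by simp [ae_iff]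
          filter_upwards [hne] with s hst hs
          exact hbound s ⟨hs.1, lt_of_le_of_ne hs.2 hst⟩)
        ((hbeta n t ht.1).1.const_mul _)
    rw [intervalIntegral.integral_const_mul, (hbeta n t ht.1).2, Real.norm_eq_abs] at hle
    rw [hkey, abs_mul, abs_mul, abs_neg, abs_of_pos (inv_pos.2 hΓ)]
    have h2 : Real.Gamma (α * n + 1) ≠ 0 := (Real.Gamma_pos_of_pos (by positivity)).ne'
    calc _ ≤ _ := mul_le_mul_of_nonneg_left hle (by positivity)
      _ = _ := by
        rw [mul_pow, pow_succ |lam|]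
        field_simp

theorem continuous_mittagLeffler {α : ℝ} (hα : 0 < α) : Continuous (mittagLeffler α 1) := by
  refine continuous_iff_continuousAt.2 fun x => ?_
  have hc : ContinuousOn (mittagLeffler α 1) (Metric.ball 0 (|x| + 1)) := by
    refine continuousOn_tsum (fun k => by fun_prop) (summable_mittagLeffler hα (|x| + 1))
      fun k y hy => ?_
    have hΓ : 0 < Real.Gamma (α * k + 1) := Real.Gamma_pos_of_pos (by positivity)
    rw [norm_div, norm_pow, Real.norm_of_nonneg hΓ.le]
    have : ‖y‖ ≤ |x| + 1 := by simpa using (mem_ball_zero_iff.1 hy).le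
    gcongr
  refine hc.continuousAt (Metric.isOpen_ball.mem_nhds ?_)
  simp

/-- The scalar fractional relaxation equation is solved by the Mittag-Leffler function. -/
theorem eq_mul_mittagLeffler_of_hasCaputoDerivAt {α T lam : ℝ} (h0 : 0 < α) (h1 : α ≤ 1)
    (hT : 0 < T) {g : ℝ → ℝ} (hg : ContinuousOn g (Icc 0 T))
    (h : ∀ t ∈ Ioo 0 T, HasCaputoDerivAt α g (-lam * g t) t) :
    ∀ t ∈ Icc 0 T, g t = g 0 * mittagLeffler α 1 (-lam * t ^ α) := by
  obtain ⟨M, hM⟩ := isCompact_Icc.exists_bound_of_continuousOn hg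
  have hV := fun t (ht : t ∈ Ioo 0 T) =>
    HasCaputoDerivAt.eq_add_integral h0 h1 hg (hg.const_mul (-lam)) h ht
  have hopen : EqOn g (fun t => g 0 * mittagLeffler α 1 (-lam * t ^ α)) (Ioo 0 T) := by
    intro t ht
    have hb := fun n => abs_sub_sum_le_of_volterra h0 hg hM hV n t ht
    have hz : Filter.Tendsto (fun n : ℕ => M * ((|lam| * t ^ α) ^ n / Real.Gamma (α * n + 1)))
        Filter.atTop (nhds 0) := by
      simpa using (summable_mittagLeffler h0 (|lam| * t ^ α)).tendsto_atTop_zero.const_mul M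
    have h2 := squeeze_zero_norm (f := fun n : ℕ => g t - g 0 *
      ∑ k ∈ Finset.range n, (-lam * t ^ α) ^ k / Real.Gamma (α * k + 1)) hb hz
    have h3 := ((hasSum_mittagLeffler h0 (-lam * t ^ α)).tendsto_sum_nat.const_mul (g 0)).const_sub
      (g t)
    exact sub_eq_zero.1 (tendsto_nhds_unique h3 h2)
  -- The equation is available only on the open interval; continuity supplies the endpoints.
  refine hopen.of_subset_closure hg ?_ Ioo_subset_Icc_self (closure_Ioo hT.ne).symm.subset
  exact (((continuous_mittagLeffler h0).comp
    ((Real.continuous_rpow_const h0.le).const_mul (-lam))).const_mul _).continuousOn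

/-! ### Parseval and Hölder for coefficient sequences -/

theorem HilbertBasis.hasSum_norm_inner_sq {ι 𝕜 H : Type*} [RCLike 𝕜] [NormedAddCommGroup H]
    [InnerProductSpace 𝕜 H] (b : HilbertBasis ι 𝕜 H) (x : H) :
    HasSum (fun i => ‖inner 𝕜 (b i) x‖ ^ 2) (‖x‖ ^ 2) := by
  have h := (RCLike.reCLM (K := 𝕜)).hasSum (b.hasSum_inner_mul_inner x x)
  simp only [RCLike.reCLM_apply, inner_mul_symm_re_eq_norm, norm_mul,
    norm_inner_symm x, ← sq, inner_self_eq_norm_sq] at h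
  exact h

theorem le_rpow_mul_rpow_of_hasSum {ι : Type*} {a b c : ι → ℝ} {A B C K θ : ℝ} (hK : 0 ≤ K)
    (h0 : 0 < θ) (h1 : θ < 1) (ha : ∀ i, 0 ≤ a i) (hb : ∀ i, 0 ≤ b i) (hA : HasSum a A)
    (hB : HasSum b B) (hC : HasSum c C) (hc : ∀ i, c i ≤ K * (a i ^ (1 - θ) * b i ^ θ)) :
    C ≤ K * (A ^ (1 - θ) * B ^ θ) := by
  have h1' : 0 < 1 - θ := sub_pos.2 h1
  have hpq : (1 - θ)⁻¹.HolderConjugate θ⁻¹ :=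
    Real.holderConjugate_iff.2 ⟨(one_lt_inv₀ h1').2 (by linarith), by simp⟩
  have hA0 : 0 ≤ A := hA.nonneg ha
  have hB0 : 0 ≤ B := hB.nonneg hb
  obtain ⟨D, -, hD, hDs⟩ := Real.inner_le_Lp_mul_Lq_hasSum_of_nonneg hpq
    (A := A ^ (1 - θ)) (B := B ^ θ) (f := fun i => a i ^ (1 - θ)) (g := fun i => b i ^ θ)
    (Real.rpow_nonneg hA0 _) (Real.rpow_nonneg hB0 _) (fun i => Real.rpow_nonneg (ha i) _)
    (fun i => Real.rpow_nonneg (hb i) _)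
    (by simpa only [Real.rpow_rpow_inv hA0 h1'.ne', fun i => Real.rpow_rpow_inv (ha i) h1'.ne'])
    (by simpa only [Real.rpow_rpow_inv hB0 h0.ne', fun i => Real.rpow_rpow_inv (hb i) h0.ne'])
  exact (hasSum_le hc hC (hDs.mul_left K)).trans (mul_le_mul_of_nonneg_left hD hK)

/-! ### Spectral decomposition through the resolvent -/

section Operators

universe u v
variable {𝕜 : Type u} {H : Type v} [RCLike 𝕜] [NormedAddCommGroup H] [InnerProductSpace 𝕜 H]

theorem IsBoundedAboveBy.le_of_apply_eq {A : H →ₗ.[𝕜] H} {κ r : ℝ} (h : IsBoundedAboveBy A κ)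
    {x : A.domain} (hx : (x : H) ≠ 0) (hr : A x = (r : 𝕜) • (x : H)) : r ≤ κ := by
  have h1 := h x
  rw [hr, inner_smul_left, RCLike.conj_ofReal, RCLike.re_ofReal_mul, inner_self_eq_norm_sq] at h1
  exact le_of_mul_le_mul_right h1 (by positivity)

variable [CompleteSpace H]

theorem LinearPMap.inner_map_eq_of_isSelfAdjoint {A : H →ₗ.[𝕜] H} (hself : IsSelfAdjoint A)
    (x y : A.domain) : inner 𝕜 (A x) (y : H) = inner 𝕜 (x : H) (A y) := by
  have h := LinearPMap.adjoint_isFormalAdjoint hself.dense_domain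
  rw [LinearPMap.isSelfAdjoint_def.1 hself] at h
  exact h x y

theorem IsResolventOf.isSymmetric {A : H →ₗ.[𝕜] H} (hself : IsSelfAdjoint A) {μ : ℝ}
    {R : H →L[𝕜] H} (hR : IsResolventOf A μ R) : (R : H →ₗ[𝕜] H).IsSymmetric := by
  intro x y
  obtain ⟨hx, hx'⟩ := hR.1 x
  obtain ⟨hy, hy'⟩ := hR.1 y
  have h := LinearPMap.inner_map_eq_of_isSelfAdjoint hself ⟨R x, hx⟩ ⟨R y, hy⟩
  calc inner 𝕜 (R x) y = inner 𝕜 (R x) ((μ : 𝕜) • R y - A ⟨R y, hy⟩) := by rw [hy']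
    _ = inner 𝕜 ((μ : 𝕜) • R x - A ⟨R x, hx⟩) (R y) := by
        rw [inner_sub_left, inner_sub_right, inner_smul_left, inner_smul_right, RCLike.conj_ofReal,
          h]
    _ = inner 𝕜 x (R y) := by rw [hx']

/-- Injectivity of `R` gives `c ≠ 0`, and symmetry makes `c` real; the resolvent identity is then
solved for `A x`. -/
theorem IsResolventOf.apply_eigenvector {A : H →ₗ.[𝕜] H} (hself : IsSelfAdjoint A) {μ : ℝ}
    {R : H →L[𝕜] H} (hR : IsResolventOf A μ R) {c : 𝕜} {x : H} (hx : x ≠ 0) (hc : R x = c • x) :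
    ∃ h : x ∈ A.domain, A ⟨x, h⟩ = ((μ - (RCLike.re c)⁻¹ : ℝ) : 𝕜) • x := by
  obtain ⟨hd, he⟩ := hR.1 x
  have hc0 : c ≠ 0 := by
    rintro rfl
    have h0 : (⟨R x, hd⟩ : A.domain) = 0 := Subtype.ext (by simp [hc])
    rw [h0, LinearPMap.map_zero, hc] at he
    exact hx (by simpa using he.symm)
  have hev : Module.End.HasEigenvalue (R : H →ₗ[𝕜] H) c :=
    Module.End.hasEigenvalue_of_hasEigenvector (x := x)
      ⟨Module.End.mem_eigenspace_iff.2 hc, hx⟩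
  have hre : ((RCLike.re c : ℝ) : 𝕜) = c :=
    RCLike.conj_eq_iff_re.1 ((hR.isSymmetric hself).conj_eigenvalue_eq_self hev)
  have hxd : x ∈ A.domain := by
    have := A.domain.smul_mem c⁻¹ hd
    rwa [hc, inv_smul_smul₀ hc0] at this
  refine ⟨hxd, ?_⟩
  have h1 : (⟨R x, hd⟩ : A.domain) = c • ⟨x, hxd⟩ := Subtype.ext hc
  rw [h1, LinearPMap.map_smul, hc] at he
  have h2 : c • A ⟨x, hxd⟩ = c • (((μ - (RCLike.re c)⁻¹ : ℝ) : 𝕜) • x) := by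
    rw [RCLike.ofReal_sub, RCLike.ofReal_inv, hre, sub_smul, smul_sub, smul_inv_smul₀ hc0, smul_comm c (μ : 𝕜) x]
    exact (sub_eq_iff_eq_add.2 (sub_eq_iff_eq_add'.1 he)).symm
  exact smul_right_injective H hc0 h2

/-- A compact self-adjoint operator has a Hilbert basis of eigenvectors. -/
theorem exists_hilbertBasis_forall_apply_eq_smul {R : H →L[𝕜] H} (hc : IsCompactOperator R)
    (hs : (R : H →ₗ[𝕜] H).IsSymmetric) :
    ∃ (ι : Type (max u v)) (b : HilbertBasis ι 𝕜 H) (c : ι → 𝕜), ∀ i, R (b i) = c i • b i := by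
  let V : 𝕜 → Submodule 𝕜 H := fun c => Module.End.eigenspace (R : H →ₗ[𝕜] H) c
  have hV : ∀ c x, x ∈ V c ↔ R x = c • x := fun c x => Module.End.mem_eigenspace_iff
  have hcomplete : ∀ c, CompleteSpace (V c) := fun c => by
    have : IsClosed (V c : Set H) := by
      have h : (V c : Set H) = {x | R x = c • x} := by ext x; exact hV c x
      rw [h]
      exact isClosed_eq R.continuous (continuous_const_smul c)
    exact this.completeSpace_coe
  -- Every scalar `c` is allowed: a trivial eigenspace contributes an empty basis.
  choose w b hb using fun c => exists_hilbertBasis 𝕜 (V c)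
  have hon := hs.orthogonalFamily_eigenspaces.orthonormal_sigma_orthonormal
    (fun c => (b c).orthonormal)
  have hbot : (Submodule.span 𝕜 (range fun a : Σ c, w c =>
      (V a.1).subtypeₗᵢ (b a.1 a.2)))ᗮ = ⊥ := by
    rw [eq_bot_iff, ← ContinuousLinearMap.orthogonalComplement_iSup_eigenspaces_eq_bot hc hs,
      ← Submodule.iInf_orthogonal]
    intro x hx
    refine Submodule.mem_iInf _ |>.2 fun c => ?_
    have hf : (innerSL 𝕜 x).comp (V c).subtypeL = 0 := by
      refine ContinuousLinearMap.ext_on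
        (Submodule.dense_iff_topologicalClosure_eq_top.2 (b c).dense_span) ?_
      rintro _ ⟨i, rfl⟩
      exact (Submodule.mem_orthogonal' _ x).1 hx _ (Submodule.subset_span ⟨⟨c, i⟩, rfl⟩)
    refine (Submodule.mem_orthogonal' _ x).2 fun y hy => ?_
    exact DFunLike.congr_fun hf (⟨y, hy⟩ : V c)
  refine ⟨Σ c, w c, HilbertBasis.mkOfOrthogonalEqBot hon hbot, Sigma.fst, fun i => ?_⟩
  rw [HilbertBasis.coe_mkOfOrthogonalEqBot]
  exact (hV _ _).1 (b i.1 i.2).2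

theorem IsResolventOf.exists_hilbertBasis {A : H →ₗ.[𝕜] H} (hself : IsSelfAdjoint A) {μ : ℝ}
    {R : H →L[𝕜] H} (hR : IsResolventOf A μ R) (hc : IsCompactOperator R) :
    ∃ (ι : Type (max u v)) (b : HilbertBasis ι 𝕜 H) (lam : ι → ℝ),
      ∀ i, ∃ h : b i ∈ A.domain, A ⟨b i, h⟩ = ((-lam i : ℝ) : 𝕜) • b i := by
  obtain ⟨ι, b, c, hbc⟩ := exists_hilbertBasis_forall_apply_eq_smul hc (hR.isSymmetric hself)
  refine ⟨ι, b, fun i => -(μ - (RCLike.re (c i))⁻¹), fun i => ?_⟩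
  simpa only [neg_neg] using hR.apply_eigenvector hself (b.orthonormal.ne_zero i) (hbc i)

/-! ### The estimate for solutions -/

theorem IsBackwardSolution.norm_inner_eq {A : H →ₗ.[𝕜] H} (hself : IsSelfAdjoint A)
    {α T lam : ℝ} (h0 : 0 < α) (h1 : α ≤ 1) (hT : 0 < T) {uT : H} {u : ℝ → H}
    (hu : IsBackwardSolution α T A uT u) {e : A.domain}
    (he : A e = ((-lam : ℝ) : 𝕜) • (e : H)) {t : ℝ} (ht : t ∈ Icc 0 T) :
    ‖inner 𝕜 (e : H) (u t)‖ = mittagLeffler α 1 (-lam * t ^ α) * ‖inner 𝕜 (e : H) (u 0)‖ := by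
  have hcont : ContinuousOn (fun s => inner 𝕜 (e : H) (u s)) (Icc 0 T) :=
    continuousOn_const.inner hu.continuousOn
  have heq : ∀ τ ∈ Ioo 0 T, HasCaputoDerivAt α (fun s => inner 𝕜 (e : H) (u s))
      (((-lam : ℝ) : 𝕜) * inner 𝕜 (e : H) (u τ)) τ := fun τ hτ => by
    obtain ⟨hd, hder⟩ := hu.equation τ hτ
    have := hder e
    rwa [← LinearPMap.inner_map_eq_of_isSelfAdjoint hself e ⟨u τ, hd⟩, he, inner_smul_left,
      RCLike.conj_ofReal] at this
  have hre := eq_mul_mittagLeffler_of_hasCaputoDerivAt h0 h1 hT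
    (g := fun s => RCLike.re (inner 𝕜 (e : H) (u s)))
    (RCLike.continuous_re.comp_continuousOn hcont) (lam := lam) (fun τ hτ => by
      simpa only [RCLike.reCLM_apply, RCLike.re_ofReal_mul] using
        (heq τ hτ).clm_comp RCLike.reCLM hτ.1) t ht
  have him := eq_mul_mittagLeffler_of_hasCaputoDerivAt h0 h1 hT
    (g := fun s => RCLike.im (inner 𝕜 (e : H) (u s)))
    (RCLike.continuous_im.comp_continuousOn hcont) (lam := lam) (fun τ hτ => by
      simpa only [RCLike.imCLM_apply, RCLike.im_ofReal_mul] using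
        (heq τ hτ).clm_comp RCLike.imCLM hτ.1) t ht
  have hval : inner 𝕜 (e : H) (u t)
      = ((mittagLeffler α 1 (-lam * t ^ α) : ℝ) : 𝕜) * inner 𝕜 (e : H) (u 0) := by
    apply RCLike.ext
    · rw [RCLike.re_ofReal_mul, mul_comm]; exact hre
    · rw [RCLike.im_ofReal_mul, mul_comm]; exact him
  rw [hval, norm_mul, RCLike.norm_ofReal, abs_of_nonneg (mittagLeffler_nonneg h0 h1 _)]

theorem IsBackwardSolution.norm_le {A : H →ₗ.[𝕜] H} (hself : IsSelfAdjoint A)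
    {α T m : ℝ} (h0 : 0 < α) (h1 : α ≤ 1) (hT : 0 < T) {ι : Type*} (b : HilbertBasis ι 𝕜 H)
    {lam : ι → ℝ} (hb : ∀ i, ∃ h : b i ∈ A.domain, A ⟨b i, h⟩ = ((-lam i : ℝ) : 𝕜) • b i)
    (hm : ∀ i, -m ≤ lam i) {uT : H} {u : ℝ → H} (hu : IsBackwardSolution α T A uT u)
    {t : ℝ} (ht : t ∈ Icc 0 T) :
    ‖u t‖ ≤ max 1 (mittagLeffler α 1 (m * T ^ α)) * ‖u 0‖ ^ (1 - t / T) * ‖u T‖ ^ (t / T) := by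
  set K := max 1 (mittagLeffler α 1 (m * T ^ α)) with hKdef
  have hK : 1 ≤ K := le_max_left _ _
  have hK0 : 0 ≤ K := zero_le_one.trans hK
  -- The endpoints are split off because Hölder's inequality needs `0 < t / T < 1`.
  rcases ht.1.eq_or_lt with rfl | ht0
  · simpa using le_mul_of_one_le_left (norm_nonneg (u 0)) hK
  rcases ht.2.eq_or_lt with rfl | htT
  · simpa [div_self hT.ne'] using le_mul_of_one_le_left (norm_nonneg (u t)) hK
  have hθ0 : 0 < t / T := div_pos ht0 hT
  have hθ1 : t / T < 1 := (div_lt_one hT).2 htT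
  have hterm : ∀ i, ‖inner 𝕜 (b i) (u t)‖ ^ 2 ≤ K ^ 2 *
      ((‖inner 𝕜 (b i) (u 0)‖ ^ 2) ^ (1 - t / T) * (‖inner 𝕜 (b i) (u T)‖ ^ 2) ^ (t / T)) :=
      fun i => by
    obtain ⟨hd, he⟩ := hb i
    have ht' := hu.norm_inner_eq hself h0 h1 hT he ht
    have hT' := hu.norm_inner_eq hself h0 h1 hT he ⟨hT.le, le_rfl⟩
    simp only at ht' hT'
    have hE := mittagLeffler_rpow_le h0 h1 hT (hm i) ht.1 ht.2
    have hET := mittagLeffler_nonneg h0 h1 (-lam i * T ^ α)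
    set x := ‖inner 𝕜 (b i) (u 0)‖
    have hx : 0 ≤ x := norm_nonneg _
    have hle : ‖inner 𝕜 (b i) (u t)‖
        ≤ K * (x ^ (1 - t / T) * ‖inner 𝕜 (b i) (u T)‖ ^ (t / T)) := by
      rw [ht', hT', Real.mul_rpow hET hx]
      have hxx : x ^ (1 - t / T) * x ^ (t / T) = x := by
        rw [← Real.rpow_add' hx (by simp), sub_add_cancel, Real.rpow_one]
      calc _ ≤ (K * mittagLeffler α 1 (-lam i * T ^ α) ^ (t / T)) * x := by gcongr
        _ = (K * mittagLeffler α 1 (-lam i * T ^ α) ^ (t / T)) *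
            (x ^ (1 - t / T) * x ^ (t / T)) := by rw [hxx]
        _ = _ := by ring
    rw [← Real.rpow_pow_comm hx, ← Real.rpow_pow_comm (norm_nonneg _), ← mul_pow, ← mul_pow]
    gcongr
  have hfin := le_rpow_mul_rpow_of_hasSum (sq_nonneg K) hθ0 hθ1 (fun i => sq_nonneg _)
    (fun i => sq_nonneg _) (b.hasSum_norm_inner_sq (u 0)) (b.hasSum_norm_inner_sq (u T))
    (b.hasSum_norm_inner_sq (u t)) hterm
  rw [← Real.rpow_pow_comm (norm_nonneg _), ← Real.rpow_pow_comm (norm_nonneg _), ← mul_pow,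
    ← mul_pow, ← mul_assoc] at hfin
  exact le_of_sq_le_sq hfin (by positivity)

end Operators

theorem theorem1 {𝕜 H : Type*} [RCLike 𝕜] [NormedAddCommGroup H] [InnerProductSpace 𝕜 H]
    [CompleteSpace H] [TopologicalSpace.SeparableSpace H]
    (α T κ : ℝ) (hα0 : 0 < α) (hα1 : α ≤ 1) (hT : 0 < T) (hκ : 0 ≤ κ)
    (A : H →ₗ.[𝕜] H) (hdense : Dense (A.domain : Set H)) (hself : IsSelfAdjoint A)
    (hbdd : IsBoundedAboveBy A κ)
    (hcomp : ∃ μ : ℝ, -κ < μ ∧ ∃ R : H →L[𝕜] H, IsResolventOf A μ R ∧ IsCompactOperator R) :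
    ∃ K : ℝ, 1 ≤ K ∧ (κ = 0 → K = 1) ∧
      (∀ lam : ℝ, IsFirstEigenvalueNeg A lam → K ≤ 1 + mittagLeffler α 1 (-lam * T ^ α)) ∧
      ∀ (uT : H) (u : ℝ → H), IsBackwardSolution α T A uT u →
        ∀ t ∈ Set.Icc 0 T, ‖u t‖ ≤ K * ‖u 0‖ ^ (1 - t / T) * ‖u T‖ ^ (t / T) := by
  obtain ⟨μ, -, R, hR, hRc⟩ := hcomp
  obtain ⟨ι, b, lam, hb⟩ := hR.exists_hilbertBasis hself hRc
  have key : ∀ m : ℝ, (∀ i, -m ≤ lam i) → ∀ (uT : H) (u : ℝ → H), IsBackwardSolution α T A uT u →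
      ∀ t ∈ Set.Icc 0 T, ‖u t‖ ≤ max 1 (mittagLeffler α 1 (m * T ^ α)) *
        ‖u 0‖ ^ (1 - t / T) * ‖u T‖ ^ (t / T) := fun m hm uT u hu t ht =>
    hu.norm_le hself hα0 hα1 hT b hb hm ht
  have hTα : 0 < T ^ α := Real.rpow_pos_of_pos hT α
  -- Without a least eigenvalue, as on the zero space, `-κ` serves as the lower bound for the
  -- spectrum of `-A`.
  by_cases hex : ∃ l, IsFirstEigenvalueNeg A l
  · obtain ⟨l, hl⟩ := hex
    refine ⟨max 1 (mittagLeffler α 1 (-l * T ^ α)), le_max_left _ _, fun hκ0 => ?_,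
      fun l' hl' => ?_, key (-l) fun i => ?_⟩
    · obtain ⟨x, hx, hxl⟩ := hl.1
      have hl0 : -l ≤ κ := hbdd.le_of_apply_eq hx (by
        rw [RCLike.ofReal_neg, neg_smul, ← hxl, neg_neg])
      have := (isSubLogConvex_mittagLeffler hα0 hα1).le_one (l * T ^ α)
        (mul_nonneg (by linarith) hTα.le)
      exact max_eq_left (by simpa only [neg_mul] using this)
    · obtain rfl := hl.unique hl'
      have := mittagLeffler_nonneg hα0 hα1 (-l * T ^ α)
      exact max_le (by linarith) (by linarith)
    · obtain ⟨hd, he⟩ := hb i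
      rw [neg_neg]
      refine hl.2 ⟨⟨b i, hd⟩, b.orthonormal.ne_zero i, ?_⟩
      rw [he, RCLike.ofReal_neg, neg_smul, neg_neg]
  · refine ⟨max 1 (mittagLeffler α 1 (κ * T ^ α)), le_max_left _ _, fun hκ0 => ?_,
      fun l hl => absurd ⟨l, hl⟩ hex, key κ fun i => ?_⟩
    · rw [hκ0, zero_mul, mittagLeffler_zero hα0, max_self]
    · obtain ⟨hd, he⟩ := hb i
      have := hbdd.le_of_apply_eq (b.orthonormal.ne_zero i) he
      linarith
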